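/- All topological groups are Hausdorff, and a group topology on an abelian group is called precompact if it is Hausdorff and, for every neighbourhood $U$ of $0$, finitely many translates of $U$ cover the group. Let $\mathbb T=\mathbb R/\mathbb Z$. For a group topology $\tau$ on an abelian group $G$, let $(G,\tau)^\wedge$ be the group of $\tau$-continuous homomorphisms $G\to\mathbb T$, regarded as a subgroup of the group $\mathrm{Hom}(G,\mathbb T)$ of all characters of $G$, and let the Bohr modification $\tau^+$ be the coarsest group topology on $G$ for which all members of $(G,\tau)^\wedge$ are continuous. For a subgroup $H$ of $G$ and a Hausdorff group topology $\zeta$ on $H$, let $\bar\zeta$ be the group topology on $G$ having the $\zeta$-neighbourhoods of $0$ in $H$ as a local base at $0$; it is the finest Hausdorff group topology on $G$ that induces $\zeta$ on $H$. If $\zeta$ is precompact, a finest precompact extension of $\zeta$ is a precompact topology $\tau^*$ on $G$ with $\tau^*|_H=\zeta$ such that $\tau'\subseteq\tau^*$ for every precompact topology $\tau'$ on $G$ with $\tau'|_H=\zeta$. The subgroup $H$ is $B$-embedded in $(G,\tau)$ if every homomorphism $G/H\to\mathbb T$ is continuous for the quotient topology on $G/H$. **Theorem B.** Let $G$ be an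 abelian group and $H$ an arbitrary subgroup of $G$. (a) If $\zeta$ is a precompact topology on $H$, then $(\bar\zeta)^+$ is the finest precompact extension of $\zeta$ to $G$. (b) For a precompact topology $\tau$ on $G$ and $\zeta=\tau|_H$, the following are equivalent: - (b$_1$) $\tau$ is the finest precompact extension of $\zeta$; - (b$_2$) $H$ is $B$-embedded in $(G,\tau)$; - (b$_3$) $(G,\tau)^\wedge=(j^\wedge)^{-1}\left((H,\zeta)^\wedge\right)$, where $j^\wedge:\mathrm{Hom}(G,\mathbb T)\to\mathrm{Hom}(H,\mathbb T)$ is the restriction map $\chi\mapsto\chi|_H$; - (b$_4$) $\tau=(\bar\zeta)^+$. -/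

import Mathlib

open Topology Pointwise

noncomputable section

/-- A precompact topology on an abelian group: a Hausdorff group topology for which finitely many
translates of every neighbourhood of `0` cover the group. -/
structure IsPrecompactTopology {G : Type*} [AddCommGroup G] (τ : TopologicalSpace G) : Prop where
  isTopologicalAddGroup : @IsTopologicalAddGroup G τ _
  t2Space : @T2Space G τ
  totallyBounded : ∀ U ∈ @nhds G τ 0, ∃ F : Set G, F.Finite ∧ F + U = Set.univ

/-- `(G, τ)^∧`, the subgroup of the `τ`-continuous characters inside the group
`(G_d)^∧ = Hom(G, 𝕋)` of all characters of `G`. -/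
def continuousCharacters {G : Type*} [AddCommGroup G] (τ : TopologicalSpace G) :
    AddSubgroup (G →+ UnitAddCircle) where
  carrier := {χ | @Continuous G UnitAddCircle τ _ χ}
  add_mem' := fun {χ ψ} (hχ : Continuous χ) (hψ : Continuous ψ) => hχ.add hψ
  zero_mem' := (continuous_const : Continuous fun _ : G => (0 : UnitAddCircle))
  neg_mem' := fun {χ} (hχ : Continuous χ) => hχ.neg

/-- `σ(G, Γ)`, the coarsest topology on `G` for which all characters in `Γ` are continuous
(it is a group topology, see below). -/
@[reducible] def characterTopology {G : Type*} [AddCommGroup G] (Γ : AddSubgroup (G →+ UnitAddCircle)) :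
    TopologicalSpace G :=
  ⨅ χ ∈ Γ, TopologicalSpace.induced χ inferInstance

theorem isTopologicalAddGroup_characterTopology {G : Type*} [AddCommGroup G]
    (Γ : AddSubgroup (G →+ UnitAddCircle)) :
    @IsTopologicalAddGroup G (characterTopology Γ) _ :=
  topologicalAddGroup_iInf fun χ => topologicalAddGroup_iInf fun _ =>
    topologicalAddGroup_induced χ

/-- The Bohr modification `τ⁺ = σ(G, (G, τ)^∧)`. -/
@[reducible] def bohrModification {G : Type*} [AddCommGroup G] (τ : TopologicalSpace G) :
    TopologicalSpace G :=
  characterTopology (continuousCharacters τ)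

/-- The topology `ζ̄` on `G` for which the neighbourhoods of `0` in `(H, ζ)` form a local base
at `0` (and their translates by `g` form a local base at `g`). -/
@[reducible] def extendedTopology {G : Type*} [AddCommGroup G] (H : AddSubgroup G) (ζ : TopologicalSpace H) :
    TopologicalSpace G :=
  TopologicalSpace.mkOfNhds fun g => Filter.map (fun h : H => g + (h : G)) (@nhds H ζ 0)

theorem nhds_extendedTopology {G : Type*} [AddCommGroup G] (H : AddSubgroup G)
    (ζ : TopologicalSpace H) (hζ : @IsTopologicalAddGroup H ζ _) (g : G) :
    @nhds G (extendedTopology H ζ) g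
      = Filter.map (fun h : H => g + (h : G)) (@nhds H ζ 0) := by
  refine TopologicalSpace.nhds_mkOfNhds _ _ ?_ ?_
  · intro a
    rw [Filter.pure_le_iff]
    intro s hs
    have := mem_of_mem_nhds (Filter.mem_map.1 hs)
    simpa using this
  · intro a s hs
    rw [Filter.eventually_map]
    have h1 : ∀ᶠ h : H in 𝓝 0, ∀ᶠ k : H in 𝓝 h, a + (k : G) ∈ s :=
      eventually_eventually_nhds.2 (Filter.mem_map.1 hs)
    filter_upwards [h1] with h hh
    rw [Filter.mem_map]
    have h2 : Filter.Tendsto (fun k : H => h + k) (𝓝 0) (𝓝 h) := by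
      have hc : Continuous fun k : H => h + k := continuous_const.add continuous_id
      simpa using hc.tendsto 0
    filter_upwards [h2.eventually hh] with k hk
    simpa [add_assoc] using hk

/-- If `ζ` is a Hausdorff group topology on `H`, then `ζ̄` is the finest Hausdorff group topology
on `G` (even the finest group topology) that induces `ζ` on `H`. -/
theorem extendedTopology_isFinest {G : Type*} [AddCommGroup G] (H : AddSubgroup G)
    (ζ : TopologicalSpace H) (hζ : @IsTopologicalAddGroup H ζ _) (hT : @T2Space H ζ) :
    @IsTopologicalAddGroup G (extendedTopology H ζ) _ ∧
    @T2Space G (extendedTopology H ζ) ∧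
    TopologicalSpace.induced Subtype.val (extendedTopology H ζ) = ζ ∧
    ∀ τ : TopologicalSpace G, @IsTopologicalAddGroup G τ _ →
      TopologicalSpace.induced Subtype.val τ = ζ → extendedTopology H ζ ≤ τ := by
  have hn := nhds_extendedTopology H ζ hζ
  have hn0 : @nhds G (extendedTopology H ζ) 0 = Filter.map (Subtype.val : H → G) (@nhds H ζ 0) := by
    rw [hn 0]; simp
  have hg : @IsTopologicalAddGroup G (extendedTopology H ζ) _ := by
    let _ := extendedTopology H ζ
    refine IsTopologicalAddGroup.of_comm_of_nhds_zero ?_ ?_ ?_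
    · rw [hn0, Filter.prod_map_map_eq, Filter.tendsto_map'_iff, ← nhds_prod_eq]
      have : Filter.Tendsto (fun p : H × H => p.1 + p.2) (𝓝 (0, 0)) (𝓝 0) := by
        simpa using (continuous_add : Continuous fun p : H × H => p.1 + p.2).tendsto (0, 0)
      exact Filter.tendsto_map.comp this
    · rw [hn0, Filter.tendsto_map'_iff]
      have : Filter.Tendsto (fun p : H => -p) (𝓝 0) (𝓝 0) := by
        simpa using (continuous_neg : Continuous fun p : H => -p).tendsto 0
      exact Filter.tendsto_map.comp this
    · intro x
      rw [hn x, hn0, Filter.map_map]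
      rfl
  have hi : TopologicalSpace.induced Subtype.val (extendedTopology H ζ) = ζ := by
    refine IsTopologicalAddGroup.ext ?_ hζ ?_
    · let _ := extendedTopology H ζ
      exact topologicalAddGroup_induced H.subtype
    rw [@nhds_induced _ _ (extendedTopology H ζ)]
    change Filter.comap _ (@nhds G (extendedTopology H ζ) 0) = _
    rw [hn0, Filter.comap_map Subtype.val_injective]
  refine ⟨hg, ?_, hi, ?_⟩
  · let _ := extendedTopology H ζ
    have : T1Space G := by
      refine IsTopologicalAddGroup.t1Space G ?_
      rw [← isOpen_compl_iff, isOpen_iff_mem_nhds]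
      intro a ha
      rw [hn a, Filter.mem_map]
      by_cases haH : a ∈ H
      · have : (-⟨a, haH⟩ : H) ≠ 0 := by
          intro h
          exact ha (by simpa using congrArg Subtype.val h)
        filter_upwards [isOpen_ne.mem_nhds this.symm] with k hk h0
        apply hk
        ext
        simpa using (neg_eq_of_add_eq_zero_right h0).symm
      · refine Filter.univ_mem' fun k h0 => haH ?_
        have : a = -(k : G) := eq_neg_of_add_eq_zero_left h0
        rw [this]
        exact H.neg_mem k.2
    infer_instance
  · intro τ hτ hτζ
    rw [le_iff_nhds]
    intro g
    rw [hn g]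
    change Filter.Tendsto (fun h : H => g + (h : G)) _ _
    have hv : Continuous (Subtype.val : H → G) := continuous_iff_le_induced.2 hτζ.ge
    have : Continuous fun h : H => g + (h : G) := continuous_const.add hv
    simpa using this.tendsto 0

/-- `τ` is the finest precompact extension of `ζ` (for topologies, `τ ≤ τ'` means that `τ` is finer
than `τ'`). -/
structure IsFinestPrecompactExtension {G : Type*} [AddCommGroup G] (H : AddSubgroup G)
    (ζ : TopologicalSpace H) (τ : TopologicalSpace G) : Prop where
  isPrecompactTopology : IsPrecompactTopology τ
  induced_eq : TopologicalSpace.induced Subtype.val τ = ζ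
  finest : ∀ τ' : TopologicalSpace G, IsPrecompactTopology τ' →
    TopologicalSpace.induced Subtype.val τ' = ζ → τ ≤ τ'

/-- `H` is `B`-embedded in `(G, τ)`: every algebraic character of `G ⧸ H` is continuous for the
quotient topology. -/
def IsBEmbedded {G : Type*} [AddCommGroup G] (τ : TopologicalSpace G) (H : AddSubgroup G) : Prop :=
  ∀ χ : G ⧸ H →+ UnitAddCircle,
    @Continuous (G ⧸ H) UnitAddCircle (TopologicalSpace.coinduced (QuotientAddGroup.mk' H) τ) _ χ

/-- The dual `j^∧ : (G_d)^∧ → (H_d)^∧` of the inclusion `j : H → G`, that is, restriction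
of characters to `H`. -/
def restrictCharacter {G : Type*} [AddCommGroup G] (H : AddSubgroup G) :
    (G →+ UnitAddCircle) →+ (H →+ UnitAddCircle) :=
  AddMonoidHom.compHom' H.subtype

end

/-! By Comfort–Ross, a precompact topology is generated by its continuous characters, so comparing
precompact topologies amounts to comparing subgroups of Hom(G, 𝕋). In `extendedTopology H ζ` the
subgroup H is open, so a character is continuous exactly when its restriction to H is
(`continuousCharacters_extendedTopology`). Every precompact extension of ζ has its characters in
this preimage. The preimage itself generates a precompact extension: characters of H extend to G
because 𝕋 is divisible, and characters of G/H separate points. This gives the finest extension and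
identifies it by its characters. B-embeddedness says that the characters vanishing on H are
continuous. To reach the whole preimage, `IsBEmbedded.continuousCharacters_eq_comap` adjoins one of
its members to the dual and shows by Merson's lemma that the topology does not change. Comfort–Ross
follows by completion from Peter–Weyl for compact abelian K. There, translations and a convolution
operator on L²(K) generate a commutative C*-algebra, whose Gelfand characters yield continuous
characters of K. -/

/-! ### Group characters from Gelfand theory. -/

section CStarAlgebra

open WeakDual

/-- A homomorphism into the unit complex numbers whose underlying function is continuous is a
continuous character with values in `ℝ / ℤ`. -/
theorem exists_continuous_unitAddCircle_character {K : Type*} [AddCommGroup K]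
    [TopologicalSpace K] (f : K → ℂ) (hf : Continuous f) (hnorm : ∀ a, ‖f a‖ = 1)
    (hadd : ∀ a b, f (a + b) = f a * f b) :
    ∃ χ : K →+ UnitAddCircle, Continuous χ ∧ ∀ a, χ a = 0 → f a = 1 := by
  let e := AddCircle.homeomorphCircle (T := 1) one_ne_zero
  let g : K → Circle := fun a => ⟨f a, mem_sphere_zero_iff_norm.2 (hnorm a)⟩
  have hg : Continuous g := hf.subtype_mk _
  have hge : ∀ a, AddCircle.toCircle (e.symm (g a)) = g a := fun a => by
    rw [← AddCircle.homeomorphCircle_apply one_ne_zero]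
    exact e.apply_symm_apply (g a)
  refine ⟨AddMonoidHom.mk' (fun a => e.symm (g a)) fun a b => ?_, e.symm.continuous.comp hg,
    fun a ha => ?_⟩
  · apply AddCircle.injective_toCircle one_ne_zero
    rw [AddCircle.toCircle_add, hge, hge, hge]
    exact Subtype.ext (hadd a b)
  · have h0 : e.symm (g a) = 0 := ha
    have h1 := hge a
    rw [h0, AddCircle.toCircle_zero] at h1
    exact (congrArg Subtype.val h1).symm

/-- `U` need not be norm continuous. A Gelfand character `φ` separating `U g * S` from `S` has `φ S
≠ 0`, so `φ (U a) = φ (U a * S) / φ S` is still continuous in `a`. -/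
theorem exists_continuous_character_of_commCStarAlgebra {K A : Type*} [AddCommGroup K]
    [TopologicalSpace K] [CommCStarAlgebra A] (U : K → A) (S : A)
    (hadd : ∀ a b, U (a + b) = U a * U b) (hunit : ∀ a, star (U a) * U a = 1)
    (hcont : Continuous fun a => U a * S) (g : K) (hg : U g * S ≠ S) :
    ∃ χ : K →+ UnitAddCircle, Continuous χ ∧ χ g ≠ 0 := by
  obtain ⟨φ, hφ⟩ : ∃ φ : characterSpace ℂ A, φ (U g * S - S) ≠ 0 := by
    by_contra! h
    refine hg (sub_eq_zero.1 ((gelfandTransform_isometry A).injective ?_))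
    ext φ
    simpa using h φ
  rw [map_sub, map_mul] at hφ
  have hS : φ S ≠ 0 := fun h => hφ (by rw [h, mul_zero, sub_zero])
  have hcontU : Continuous fun a => φ (U a) := by
    have : (fun a => φ (U a)) = fun a => φ (U a * S) / φ S := by
      ext a
      rw [map_mul, mul_div_cancel_right₀ _ hS]
    rw [this]
    exact ((map_continuous φ).comp hcont).div_const _
  have hnorm : ∀ a, ‖φ (U a)‖ = 1 := fun a => by
    have h := congrArg norm (congrArg φ (hunit a))
    rw [map_mul, map_star, map_one, norm_mul, norm_star, norm_one] at h
    nlinarith [norm_nonneg (φ (U a))]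
  obtain ⟨χ, hχ, hχ1⟩ := exists_continuous_unitAddCircle_character (fun a => φ (U a)) hcontU hnorm
    fun a b => by rw [hadd, map_mul]
  exact ⟨χ, hχ, fun h => hφ (by rw [hχ1 g h, one_mul, sub_self])⟩

/-- The generators `S` and `U a` commute and form a set closed under `star`, so they lie in a
commutative closed star subalgebra. -/
theorem exists_continuous_character_of_cStarAlgebra {K A : Type*} [AddCommGroup K]
    [TopologicalSpace K] [CStarAlgebra A] (U : K → A) (S : A)
    (hadd : ∀ a b, U (a + b) = U a * U b) (hzero : U 0 = 1) (hstar : ∀ a, star (U a) = U (-a))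
    (hS : IsSelfAdjoint S) (hcomm : ∀ a, U a * S = S * U a)
    (hcont : Continuous fun a => U a * S) (g : K) (hg : U g * S ≠ S) :
    ∃ χ : K →+ UnitAddCircle, Continuous χ ∧ χ g ≠ 0 := by
  let s : Set A := insert S (Set.range U)
  have hUU : ∀ a b, U a * U b = U b * U a := fun a b => by rw [← hadd, ← hadd, add_comm]
  have hs : ∀ x ∈ s, ∀ y ∈ s, x * y = y * x := by
    rintro x (rfl | ⟨a, rfl⟩) y (rfl | ⟨b, rfl⟩)
    exacts [rfl, (hcomm b).symm, hcomm a, hUU a b]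
  have hsstar : ∀ x ∈ s, star x ∈ s := by
    rintro x (rfl | ⟨a, rfl⟩)
    · rw [hS.star_eq]; exact Set.mem_insert _ _
    · rw [hstar]; exact Or.inr ⟨_, rfl⟩
  have hcadj : IsMulCommutative (StarAlgebra.adjoin ℂ s) :=
    StarAlgebra.isMulCommutative_adjoin ℂ hs fun x hx y hy => hs x hx _ (hsstar y hy)
  let B := (StarAlgebra.adjoin ℂ s).topologicalClosure
  have hB : IsClosed (B : Set A) := StarSubalgebra.isClosed_topologicalClosure _
  have hsB : s ⊆ B := (StarAlgebra.subset_adjoin ℂ s).trans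
    (StarSubalgebra.le_topologicalClosure _)
  let _ : CommRing B := StarSubalgebra.commRingTopologicalClosure _
    fun x y => hcadj.is_comm.comm x y
  let _ : NormedCommRing B :=
    { SubringClass.toNormedRing B with mul_comm := mul_comm }
  let _ : CommCStarAlgebra B := { }
  refine exists_continuous_character_of_commCStarAlgebra (A := B)
    (fun a => ⟨U a, hsB (Or.inr ⟨a, rfl⟩)⟩) ⟨S, hsB (Or.inl rfl)⟩ (fun a b => Subtype.ext (hadd a b))
    (fun a => Subtype.ext ?_) (hcont.subtype_mk _) g fun h => hg (congrArg Subtype.val h)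
  change star (U a) * U a = 1
  rw [hstar, ← hadd, neg_add_cancel, hzero]

end CStarAlgebra

/-! ### Translations and convolutions on L² of a compact abelian group. -/

section Translation

open MeasureTheory Measure InnerProductSpace

variable {K : Type*} [AddCommGroup K] [TopologicalSpace K] [IsTopologicalAddGroup K]
  [CompactSpace K] [MeasurableSpace K] [BorelSpace K]

/-- Translation `h ↦ h (· + a)` on `L²` of a compact group with its Haar measure. -/
noncomputable def translationL2 (a : K) :
    Lp ℂ 2 (addHaar : Measure K) →L[ℂ] Lp ℂ 2 (addHaar : Measure K) :=
  (Lp.compMeasurePreservingₗᵢ ℂ (fun x : K => x + a)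
    (measurePreserving_add_right addHaar a)).toContinuousLinearMap

theorem norm_translationL2 (a : K) (h : Lp ℂ 2 (addHaar : Measure K)) :
    ‖translationL2 a h‖ = ‖h‖ :=
  LinearIsometry.norm_map _ h

theorem translationL2_zero : translationL2 (0 : K) = 1 := by
  ext1 h
  change Lp.compMeasurePreserving (fun x : K => x + 0) _ h = h
  simp only [add_zero]
  exact Lp.compMeasurePreserving_id_apply h

theorem translationL2_add (a b : K) :
    translationL2 (a + b) = translationL2 a * translationL2 b := by
  ext1 h
  change Lp.compMeasurePreserving (fun x : K => x + (a + b)) _ h =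
    Lp.compMeasurePreserving (fun x : K => x + a) _ (Lp.compMeasurePreserving (fun x : K => x + b) _ h)
  rw [← Lp.compMeasurePreserving_comp_apply]
  simp only [Function.comp_def, add_assoc]

theorem translationL2_toLp (a : K) (f : C(K, ℂ)) :
    translationL2 a (f.toLp 2 addHaar ℂ) =
      (f.comp ⟨fun x => x + a, by fun_prop⟩ : C(K, ℂ)).toLp 2 addHaar ℂ :=
  rfl

theorem inner_translationL2 (a : K) (h k : Lp ℂ 2 (addHaar : Measure K)) :
    inner ℂ (translationL2 a h) k = inner ℂ h (translationL2 (-a) k) := by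
  have : k = translationL2 a (translationL2 (-a) k) := by
    rw [← mul_apply_eq_comp, ← translationL2_add, add_neg_cancel, translationL2_zero]
    rfl
  nth_rewrite 1 [this]
  exact LinearIsometry.inner_map_map _ h _

theorem star_translationL2 (a : K) : star (translationL2 a) = translationL2 (-a) := by
  rw [ContinuousLinearMap.star_eq_adjoint]
  refine ((ContinuousLinearMap.eq_adjoint_iff _ _).2 fun h k => ?_).symm
  rw [inner_translationL2, neg_neg]

theorem continuous_translationL2_toLp (f : C(K, ℂ)) :
    Continuous fun a => translationL2 a (f.toLp 2 addHaar ℂ) := by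
  let c : C(K × K, ℂ) := ⟨fun p => f (p.2 + p.1), by fun_prop⟩
  exact (ContinuousMap.toLp 2 addHaar ℂ).continuous.comp c.curry.continuous

/-- Convolution on `L²` with a continuous function, as an operator into continuous functions. -/
noncomputable def convolutionCM (f : C(K, ℂ)) :
    Lp ℂ 2 (addHaar : Measure K) →L[ℂ] C(K, ℂ) :=
  LinearMap.mkContinuous
    { toFun := fun h => ⟨fun x => inner ℂ (translationL2 (-x) (f.toLp 2 addHaar ℂ)) h,
        ((continuous_translationL2_toLp f).comp continuous_neg).inner continuous_const⟩
      map_add' := fun h k => ContinuousMap.ext fun x =>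
        inner_add_right (translationL2 (-x) (f.toLp 2 addHaar ℂ)) h k
      map_smul' := fun c h => ContinuousMap.ext fun x =>
        inner_smul_right (translationL2 (-x) (f.toLp 2 addHaar ℂ)) h c }
    ‖f.toLp 2 addHaar ℂ‖ fun h => by
      refine (ContinuousMap.norm_le _ (by positivity)).2 fun x => ?_
      refine (norm_inner_le_norm (𝕜 := ℂ) (translationL2 (-x) (f.toLp 2 addHaar ℂ)) h).trans ?_
      rw [norm_translationL2]

theorem convolutionCM_apply (f : C(K, ℂ)) (h : Lp ℂ 2 (addHaar : Measure K)) (x : K) :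
    convolutionCM f h x = inner ℂ (translationL2 (-x) (f.toLp 2 addHaar ℂ)) h :=
  rfl

theorem convolutionCM_translationL2_apply (f : C(K, ℂ)) (a : K)
    (h : Lp ℂ 2 (addHaar : Measure K)) (x : K) :
    convolutionCM f (translationL2 a h) x = convolutionCM f h (x + a) := by
  rw [convolutionCM_apply, convolutionCM_apply, ← neg_neg a, ← inner_translationL2,
    ← mul_apply_eq_comp, ← translationL2_add, neg_neg, neg_add_rev]

/-- Convolution with a continuous function as an operator on `L²`. -/
noncomputable def convolutionL2 (f : C(K, ℂ)) :
    Lp ℂ 2 (addHaar : Measure K) →L[ℂ] Lp ℂ 2 (addHaar : Measure K) :=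
  (ContinuousMap.toLp 2 addHaar ℂ).comp (convolutionCM f)

theorem convolutionL2_mul_translationL2 (f : C(K, ℂ)) (a : K) :
    convolutionL2 f * translationL2 a = translationL2 a * convolutionL2 f := by
  ext1 h
  change (convolutionCM f (translationL2 a h)).toLp 2 addHaar ℂ =
    translationL2 a ((convolutionCM f h).toLp 2 addHaar ℂ)
  rw [translationL2_toLp]
  congr 1
  ext x
  exact convolutionCM_translationL2_apply f a h x

/-- Convolution upgrades strong continuity of translation to norm continuity: the translation moves
from `h` onto `f`, where it acts continuously, with a bound uniform in `x`. -/
theorem continuous_convolutionL2_mul_translationL2 (f : C(K, ℂ)) :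
    Continuous fun a => convolutionL2 f * translationL2 a := by
  have hc : Continuous fun a => (convolutionCM f).comp (translationL2 a) := by
    rw [continuous_iff_continuousAt]
    intro b
    have hF := (continuous_translationL2_toLp f).comp continuous_neg
    have hlim := tendsto_iff_norm_sub_tendsto_zero.1 (hF.tendsto b)
    refine tendsto_iff_norm_sub_tendsto_zero.2
      (squeeze_zero (fun _ => norm_nonneg _) (fun a => ?_) hlim)
    refine ContinuousLinearMap.opNorm_le_bound _ (norm_nonneg _) fun h => ?_
    refine (ContinuousMap.norm_le _ (by positivity)).2 fun x => ?_
    change ‖convolutionCM f (translationL2 a h) x - convolutionCM f (translationL2 b h) x‖ ≤ _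
    rw [convolutionCM_translationL2_apply, convolutionCM_translationL2_apply, convolutionCM_apply,
      convolutionCM_apply, ← inner_sub_left, neg_add, neg_add, translationL2_add, translationL2_add,
      mul_apply_eq_comp, mul_apply_eq_comp, ← map_sub]
    refine (norm_inner_le_norm _ _).trans ?_
    rw [norm_translationL2]
    rfl
  exact (ContinuousLinearMap.compL ℂ _ _ _ (ContinuousMap.toLp 2 addHaar ℂ)).continuous.comp hc

theorem exists_continuous_character_of_translate_ne (f : C(K, ℂ)) (g : K) (hfg : f (-g) ≠ f 0) :
    ∃ χ : K →+ UnitAddCircle, Continuous χ ∧ χ g ≠ 0 := by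
  set T := convolutionL2 f
  have hcommT : ∀ a, T * translationL2 a = translationL2 a * T := convolutionL2_mul_translationL2 f
  have hcommT' : ∀ a, star T * translationL2 a = translationL2 a * star T := fun a => by
    have h := congrArg star (hcommT (-a))
    rw [star_mul, star_mul, star_translationL2, neg_neg] at h
    exact h.symm
  have hcomm : ∀ a, translationL2 a * (star T * T) = star T * T * translationL2 a := fun a => by
    rw [← mul_assoc, ← hcommT', mul_assoc, ← hcommT, mul_assoc]
  refine exists_continuous_character_of_cStarAlgebra (fun a : K => translationL2 a) (star T * T)
    translationL2_add translationL2_zero star_translationL2 (IsSelfAdjoint.star_mul_self T) hcomm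
    ?_ g fun h => hfg ?_
  · simp only [hcomm, mul_assoc]
    exact continuous_const.mul (continuous_convolutionL2_mul_translationL2 f)
  -- C*-identity: with `S = star T * T` and `X = translationL2 g - 1`, `star (T * X) * (T * X) =
  -- star X * (S * X) = 0`.
  · have h0 : T * (translationL2 g - 1) = 0 := by
      rw [← CStarRing.star_mul_self_eq_zero_iff, star_mul, mul_assoc, ← mul_assoc (star T), mul_sub,
        ← hcomm, h, mul_one, sub_self, mul_zero]
    have h1 : ∀ k, convolutionCM f (translationL2 g k) = convolutionCM f k := fun k => by
      refine ContinuousMap.toLp_injective (addHaar : Measure K) (p := 2) (𝕜 := ℂ) ?_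
      have := DFunLike.congr_fun h0 k
      rw [mul_apply_eq_comp, _root_.sub_apply, map_sub] at this
      exact sub_eq_zero.1 this
    have h2 : translationL2 (-g) (f.toLp 2 addHaar ℂ) = f.toLp 2 addHaar ℂ := by
      refine ext_inner_right ℂ fun k => ?_
      rw [inner_translationL2, neg_neg]
      have := DFunLike.congr_fun (h1 k) 0
      rwa [convolutionCM_apply, convolutionCM_apply, neg_zero, translationL2_zero] at this
    rw [translationL2_toLp] at h2
    -- Continuous functions equal in L² are equal pointwise; at `0` this reads `f (-g) = f 0`.
    have h3 := DFunLike.congr_fun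
      (ContinuousMap.toLp_injective (addHaar : Measure K) (p := 2) (𝕜 := ℂ) h2) 0
    simpa using h3

end Translation

/-- **Peter–Weyl** for compact abelian groups: the continuous characters separate points. -/
theorem exists_continuous_character_ne_zero {K : Type*} [AddCommGroup K] [TopologicalSpace K]
    [IsTopologicalAddGroup K] [CompactSpace K] [T2Space K] {g : K} (hg : g ≠ 0) :
    ∃ χ : K →+ UnitAddCircle, Continuous χ ∧ χ g ≠ 0 := by
  let _ : MeasurableSpace K := borel K
  have : BorelSpace K := ⟨rfl⟩
  obtain ⟨f, hf0, hf1, -⟩ := exists_continuous_zero_one_of_isClosed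
    (isClosed_singleton (x := -g)) (isClosed_singleton (x := (0 : K))) (by simpa using hg)
  refine exists_continuous_character_of_translate_ne
    ⟨fun x => (f x : ℂ), Complex.continuous_ofReal.comp f.continuous⟩ g ?_
  simp [hf0 rfl, hf1 rfl]

/-! ### Topologies generated by characters, and Comfort–Ross. -/

section Characters

variable {A G : Type*} [AddCommGroup A] [AddCommGroup G]

theorem exists_extend_character (f : A →+ G) (hf : Function.Injective f)
    (χ : A →+ UnitAddCircle) : ∃ ψ : G →+ UnitAddCircle, ψ.comp f = χ :=
  (Module.Baer.of_divisible UnitAddCircle).extension_property_addMonoidHom f hf χ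

theorem exists_character_ne_zero {g : G} (hg : g ≠ 0) : ∃ χ : G →+ UnitAddCircle, χ g ≠ 0 := by
  obtain ⟨c, hc⟩ := CharacterModule.exists_character_apply_ne_zero_of_ne_zero hg
  let i : AddCircle (1 : ℚ) →+ UnitAddCircle :=
    QuotientAddGroup.map _ _ (Rat.castHom ℝ).toAddMonoidHom (by
      rw [AddSubgroup.zmultiples_le]
      exact ⟨1, by simp⟩)
  refine ⟨i.comp (c : G →+ AddCircle (1 : ℚ)), fun h => hc ?_⟩
  -- ℚ/ℤ embeds in ℝ/ℤ, so a nonzero value stays nonzero.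
  have hi : ∀ x, i x = 0 → x = 0 := by
    intro x
    induction x using QuotientAddGroup.induction_on with
    | H q =>
      intro hq
      obtain ⟨n, hn⟩ := (AddCircle.coe_eq_zero_iff (1 : ℝ)).1 (by simpa [i] using hq)
      refine (AddCircle.coe_eq_zero_iff (1 : ℚ)).2 ⟨n, ?_⟩
      simp only [zsmul_eq_mul, mul_one] at hn ⊢
      exact_mod_cast hn
  exact hi _ h

theorem characterTopology_anti {Γ Δ : AddSubgroup (G →+ UnitAddCircle)} (h : Γ ≤ Δ) :
    characterTopology Δ ≤ characterTopology Γ :=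
  le_iInf₂ fun χ hχ => iInf₂_le χ (h hχ)

theorem continuous_characterTopology {Γ : AddSubgroup (G →+ UnitAddCircle)}
    {χ : G →+ UnitAddCircle} (hχ : χ ∈ Γ) : @Continuous _ _ (characterTopology Γ) _ χ :=
  continuous_iff_le_induced.2 (iInf₂_le χ hχ)

theorem le_characterTopology_iff {τ : TopologicalSpace G} {Γ : AddSubgroup (G →+ UnitAddCircle)} :
    τ ≤ characterTopology Γ ↔ Γ ≤ continuousCharacters τ :=
  ⟨fun h _ hχ => continuous_le_dom h (continuous_characterTopology hχ),
    fun h => le_iInf₂ fun _ hχ => continuous_iff_le_induced.1 (h hχ)⟩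

theorem le_bohrModification (τ : TopologicalSpace G) : τ ≤ bohrModification τ :=
  le_characterTopology_iff.2 le_rfl

theorem induced_characterTopology (f : A →+ G) (Γ : AddSubgroup (G →+ UnitAddCircle)) :
    TopologicalSpace.induced f (characterTopology Γ) =
      characterTopology (Γ.map (AddMonoidHom.compHom' f)) := by
  simp only [characterTopology, induced_iInf, induced_compose]
  refine le_antisymm (le_iInf₂ ?_) (le_iInf₂ fun χ hχ => iInf₂_le (χ.comp f) ⟨χ, hχ, rfl⟩)
  rintro _ ⟨χ, hχ, rfl⟩
  exact iInf₂_le χ hχ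

/-- The evaluation map of `G` into the power of the circle indexed by `Γ`. -/
def evaluationHom (Γ : AddSubgroup (G →+ UnitAddCircle)) : G →+ (Γ → UnitAddCircle) where
  toFun g χ := χ.1 g
  map_zero' := funext fun χ => map_zero χ.1
  map_add' a b := funext fun χ => map_add χ.1 a b

theorem characterTopology_eq_induced (Γ : AddSubgroup (G →+ UnitAddCircle)) :
    characterTopology Γ = TopologicalSpace.induced (evaluationHom Γ) inferInstance := by
  simp only [characterTopology, Pi.topologicalSpace, induced_iInf, induced_compose, iInf_subtype']
  rfl

theorem t2Space_characterTopology {Γ : AddSubgroup (G →+ UnitAddCircle)}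
    (hΓ : ∀ g ≠ 0, ∃ χ ∈ Γ, χ g ≠ 0) : @T2Space G (characterTopology Γ) := by
  have hinj : Function.Injective (evaluationHom Γ) := by
    refine (injective_iff_map_eq_zero _).2 fun g hg => ?_
    by_contra h
    obtain ⟨χ, hχ, hne⟩ := hΓ g h
    exact hne (congrFun hg ⟨χ, hχ⟩)
  rw [characterTopology_eq_induced]
  let _ := TopologicalSpace.induced (evaluationHom Γ) inferInstance
  exact T2Space.of_injective_continuous hinj continuous_induced_dom

theorem exists_finite_add_eq_univ_of_induced {P : Type*} [AddCommGroup P] [TopologicalSpace P]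
    [IsTopologicalAddGroup P] [CompactSpace P] (e : G →+ P) {U : Set G}
    (hU : U ∈ @nhds G (TopologicalSpace.induced e inferInstance) 0) :
    ∃ F : Set G, F.Finite ∧ F + U = Set.univ := by
  rw [nhds_induced, map_zero] at hU
  obtain ⟨V, hV, hVU⟩ := hU
  obtain ⟨W, hW, hWV⟩ := exists_nhds_half_neg hV
  obtain ⟨t, -, ht⟩ := isCompact_univ.elim_nhds_subcover (fun x : P => (fun y => y - x) ⁻¹' W)
    fun x _ => (continuous_sub_right x).continuousAt.preimage_mem_nhds (by simpa using hW)
  -- Centres whose translate of `W` misses the image of `e` get a junk value, which is harmless.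
  choose! s hs using fun (x : P) (hx : ∃ g, e g - x ∈ W) => hx
  refine ⟨s '' t, t.finite_toSet.image s, Set.eq_univ_of_forall fun g => ?_⟩
  obtain ⟨x, hx, hgx⟩ := Set.mem_iUnion₂.1 (ht (Set.mem_univ (e g)))
  refine ⟨s x, ⟨x, hx, rfl⟩, g - s x, hVU ?_, add_sub_cancel _ _⟩
  have := hWV _ hgx _ (hs x ⟨g, hgx⟩)
  rwa [sub_sub_sub_cancel_right, ← map_sub] at this

theorem isPrecompactTopology_characterTopology {Γ : AddSubgroup (G →+ UnitAddCircle)}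
    (hΓ : ∀ g ≠ 0, ∃ χ ∈ Γ, χ g ≠ 0) : IsPrecompactTopology (characterTopology Γ) where
  isTopologicalAddGroup := isTopologicalAddGroup_characterTopology Γ
  t2Space := t2Space_characterTopology hΓ
  totallyBounded U hU := by
    rw [characterTopology_eq_induced] at hU
    exact exists_finite_add_eq_univ_of_induced _ hU

theorem exists_mem_ne_zero_of_t2Space {Γ : AddSubgroup (G →+ UnitAddCircle)}
    (h : @T2Space G (characterTopology Γ)) {g : G} (hg : g ≠ 0) : ∃ χ ∈ Γ, χ g ≠ 0 := by
  by_contra! hΓ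
  rw [characterTopology_eq_induced] at h
  let _ := TopologicalSpace.induced (evaluationHom Γ) inferInstance
  refine hg (nhds_injective ?_)
  rw [nhds_induced, nhds_induced, map_zero, show evaluationHom Γ g = 0 from
    funext fun χ => hΓ χ.1 χ.2]

/-- A compact Hausdorff abelian group carries the topology induced by its continuous characters. -/
theorem eq_bohrModification_of_compactSpace (K : Type*) [AddCommGroup K] [τ : TopologicalSpace K]
    [IsTopologicalAddGroup K] [CompactSpace K] [T2Space K] : τ = bohrModification τ := by
  refine le_antisymm (le_bohrModification τ) (continuous_id_iff_le.1 ?_)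
  have := t2Space_characterTopology (Γ := continuousCharacters τ) fun g hg =>
    exists_continuous_character_ne_zero hg
  exact (@Continuous.continuous_symm_of_equiv_compact_to_t2 K K τ (bohrModification τ) _ this
    (Equiv.refl K) (continuous_id_iff_le.2 (le_bohrModification τ)))

/-- **Comfort–Ross**: a precompact topology is the topology generated by its continuous
characters. -/
theorem IsPrecompactTopology.eq_bohrModification {τ : TopologicalSpace G}
    (hτ : IsPrecompactTopology τ) : τ = bohrModification τ := by
  have := hτ.isTopologicalAddGroup
  have := hτ.t2Space
  let _ : UniformSpace G := IsTopologicalAddGroup.rightUniformSpace G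
  have : IsUniformAddGroup G := isUniformAddGroup_of_addCommGroup
  have htb : TotallyBounded (Set.univ : Set G) := by
    rw [totallyBounded_iff_subset_finite_iUnion_nhds_zero]
    intro U hU
    obtain ⟨F, hF, hFU⟩ := hτ.totallyBounded U hU
    refine ⟨F, hF, ?_⟩
    rintro g -
    obtain ⟨a, ha, u, hu, rfl⟩ := hFU.ge (Set.mem_univ g)
    exact Set.mem_iUnion₂.2 ⟨a, ha, u, hu, rfl⟩
  have : CompactSpace (UniformSpace.Completion G) := by
    refine ⟨isCompact_iff_totallyBounded_isComplete.2 ⟨?_, isComplete_univ⟩⟩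
    have := (htb.image (UniformSpace.Completion.uniformContinuous_coe G)).closure
    rwa [Set.image_univ, UniformSpace.Completion.denseRange_coe.closure_range] at this
  have hK := eq_bohrModification_of_compactSpace (UniformSpace.Completion G)
  refine le_antisymm (le_bohrModification τ) ?_
  have hind : τ = TopologicalSpace.induced (UniformSpace.Completion.toCompl : G →+ _)
      (inferInstance : TopologicalSpace (UniformSpace.Completion G)) :=
    (UniformSpace.Completion.isUniformInducing_coe G).isInducing.eq_induced
  -- `τ` is generated by restrictions of characters of the completion, all of them `τ`-continuous.
  rw [hK, induced_characterTopology] at hind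
  exact (characterTopology_anti (le_characterTopology_iff.1 hind.le)).trans hind.ge

end Characters

/-! ### Extension from a subgroup, and B-embedding. -/

section Subgroups

variable {G : Type*} [AddCommGroup G]

theorem IsPrecompactTopology.exists_mem_ne_zero {τ : TopologicalSpace G}
    (hτ : IsPrecompactTopology τ) {g : G} (hg : g ≠ 0) : ∃ χ ∈ continuousCharacters τ, χ g ≠ 0 := by
  have h := hτ.t2Space
  rw [hτ.eq_bohrModification] at h
  exact exists_mem_ne_zero_of_t2Space h hg

theorem image_mk_mem_nhds_coinduced [τ : TopologicalSpace G] [IsTopologicalAddGroup G]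
    (H : AddSubgroup G) {V : Set G} (hV : V ∈ 𝓝 0) :
    QuotientAddGroup.mk' H '' V ∈
      @nhds (G ⧸ H) (TopologicalSpace.coinduced (QuotientAddGroup.mk' H) τ) 0 :=
  QuotientAddGroup.isOpenMap_coe.image_mem_nhds hV

theorem preimage_mk_mem_nhds {τ : TopologicalSpace G} (H : AddSubgroup G) {U : Set (G ⧸ H)}
    (hU : U ∈ @nhds (G ⧸ H) (TopologicalSpace.coinduced (QuotientAddGroup.mk' H) τ) 0) :
    QuotientAddGroup.mk' H ⁻¹' U ∈ 𝓝 (0 : G) := by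
  let _ : TopologicalSpace (G ⧸ H) := TopologicalSpace.coinduced (QuotientAddGroup.mk' H) τ
  exact (continuous_coinduced_rng (f := QuotientAddGroup.mk' H)).continuousAt.preimage_mem_nhds
    (by rwa [map_zero])

/-- **Merson's lemma**, for abelian groups: comparable group topologies that agree on a subgroup
and on the quotient are equal. -/
theorem le_of_induced_le_of_coinduced_le {H : AddSubgroup G} {τ σ : TopologicalSpace G}
    (hτ : @IsTopologicalAddGroup G τ _) (hσ : @IsTopologicalAddGroup G σ _) (hστ : σ ≤ τ)
    (hind : TopologicalSpace.induced (Subtype.val : H → G) τ ≤ TopologicalSpace.induced Subtype.val σ)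
    (hcoind : TopologicalSpace.coinduced (QuotientAddGroup.mk' H) τ ≤
      TopologicalSpace.coinduced (QuotientAddGroup.mk' H) σ) : τ ≤ σ := by
  have key : ∀ U ∈ @nhds G σ 0, U ∈ @nhds G τ 0 := by
    intro U hU
    obtain ⟨V, hV, hVU⟩ := @exists_nhds_zero_half G σ _ _ U hU
    have hVH : (Subtype.val : H → G) ⁻¹' V ∈
        @nhds H (TopologicalSpace.induced Subtype.val τ) 0 := by
      refine nhds_mono hind ?_
      rw [@nhds_induced _ _ σ]
      exact Filter.preimage_mem_comap hV
    rw [@nhds_induced _ _ τ] at hVH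
    obtain ⟨W₁, hW₁, hWV⟩ := hVH
    obtain ⟨W, hW, hWW⟩ := @exists_nhds_half_neg G τ _ _ W₁ hW₁
    have hVW : V ∩ W ∈ @nhds G σ 0 := Filter.inter_mem hV (nhds_mono hστ hW)
    have himg : QuotientAddGroup.mk' H '' (V ∩ W) ∈
        @nhds (G ⧸ H) (TopologicalSpace.coinduced (QuotientAddGroup.mk' H) τ) 0 := by
      refine nhds_mono hcoind ?_
      exact @image_mk_mem_nhds_coinduced G _ σ hσ H _ hVW
    have hpre : QuotientAddGroup.mk' H ⁻¹' (QuotientAddGroup.mk' H '' (V ∩ W)) ∈ @nhds G τ 0 :=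
      preimage_mk_mem_nhds H himg
    -- Write `x = v + h` with `v ∈ V ∩ W` and `h ∈ H`. Then `h ∈ W - W` forces `h ∈ V`, so `x ∈ V +
    -- V ⊆ U`.
    filter_upwards [hpre, hW] with x hx hxW
    obtain ⟨v, ⟨hvV, hvW⟩, hvx⟩ := hx
    have hH : -v + x ∈ H := QuotientAddGroup.eq.1 hvx
    have hh : (⟨-v + x, hH⟩ : H) ∈ (Subtype.val : H → G) ⁻¹' V := by
      refine hWV ?_
      have := hWW x hxW v hvW
      rwa [sub_eq_neg_add] at this
    have := hVU v hvV _ hh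
    rwa [add_neg_cancel_left] at this
  refine continuous_id_iff_le.1 ?_
  exact @continuous_of_continuousAt_zero G τ _ hτ G _ _ σ inferInstance _ _ (AddMonoidHom.id G) key

theorem mem_comap_restrictCharacter {H : AddSubgroup G} {ζ : TopologicalSpace H}
    {χ : G →+ UnitAddCircle} :
    χ ∈ AddSubgroup.comap (restrictCharacter H) (continuousCharacters ζ) ↔
      @Continuous H UnitAddCircle ζ _ (fun h => χ h) :=
  Iff.rfl

theorem continuousCharacters_le_comap {H : AddSubgroup G} {ζ : TopologicalSpace H}
    {τ : TopologicalSpace G} (h : ζ ≤ TopologicalSpace.induced Subtype.val τ) :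
    continuousCharacters τ ≤ AddSubgroup.comap (restrictCharacter H) (continuousCharacters ζ) :=
  fun _ hχ => @Continuous.comp _ _ _ ζ τ _ _ _ hχ (continuous_iff_le_induced.2 h)

theorem continuousCharacters_extendedTopology {H : AddSubgroup G} {ζ : TopologicalSpace H}
    (hζ : IsPrecompactTopology ζ) :
    continuousCharacters (extendedTopology H ζ) =
      AddSubgroup.comap (restrictCharacter H) (continuousCharacters ζ) := by
  have hg := hζ.isTopologicalAddGroup
  obtain ⟨hG, -, hind, -⟩ := extendedTopology_isFinest H ζ hg hζ.t2Space
  refine le_antisymm (continuousCharacters_le_comap hind.ge) fun χ hχ => ?_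
  refine @continuous_of_continuousAt_zero G (extendedTopology H ζ) _ hG UnitAddCircle _ _ _ inferInstance _ _
    χ ?_
  change Filter.Tendsto χ (@nhds G (extendedTopology H ζ) 0) (𝓝 (χ 0))
  rw [nhds_extendedTopology H ζ hg 0, Filter.tendsto_map'_iff, map_zero]
  have h := (mem_comap_restrictCharacter.1 hχ).tendsto 0
  simpa [Function.comp_def] using h

theorem restrictCharacter_comp_mk' {H : AddSubgroup G} (χ : G ⧸ H →+ UnitAddCircle) :
    restrictCharacter H (χ.comp (QuotientAddGroup.mk' H)) = 0 := by
  ext h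
  change χ (QuotientAddGroup.mk' H h) = 0
  rw [QuotientAddGroup.mk'_apply, (QuotientAddGroup.eq_zero_iff (h : G)).2 h.2, map_zero]

theorem exists_mem_comap_restrictCharacter_ne_zero {H : AddSubgroup G} {ζ : TopologicalSpace H}
    (hζ : IsPrecompactTopology ζ) {g : G} (hg : g ≠ 0) :
    ∃ χ ∈ AddSubgroup.comap (restrictCharacter H) (continuousCharacters ζ), χ g ≠ 0 := by
  by_cases hgH : g ∈ H
  · obtain ⟨χ, hχ, hne⟩ := hζ.exists_mem_ne_zero (g := ⟨g, hgH⟩) fun h => hg (congrArg Subtype.val h)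
    obtain ⟨ψ, rfl⟩ := exists_extend_character H.subtype H.subtype_injective χ
    exact ⟨ψ, hχ, hne⟩
  · obtain ⟨χ, hne⟩ := exists_character_ne_zero (g := (QuotientAddGroup.mk' H g))
      fun h => hgH ((QuotientAddGroup.eq_zero_iff g).1 h)
    refine ⟨χ.comp (QuotientAddGroup.mk' H), ?_, hne⟩
    rw [AddSubgroup.mem_comap, restrictCharacter_comp_mk']
    exact zero_mem _

theorem isFinestPrecompactExtension_bohrModification {H : AddSubgroup G} {ζ : TopologicalSpace H}
    (hζ : IsPrecompactTopology ζ) :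
    IsFinestPrecompactExtension H ζ (bohrModification (extendedTopology H ζ)) := by
  rw [bohrModification, continuousCharacters_extendedTopology hζ]
  refine ⟨isPrecompactTopology_characterTopology fun g hg =>
    exists_mem_comap_restrictCharacter_ne_zero hζ hg, ?_, fun τ' hτ' hind => ?_⟩
  · have hmap : (AddSubgroup.comap (restrictCharacter H) (continuousCharacters ζ)).map
        (AddMonoidHom.compHom' H.subtype) = continuousCharacters ζ :=
      AddSubgroup.map_comap_eq_self_of_surjective (f := restrictCharacter H)
        (exists_extend_character H.subtype H.subtype_injective) _
    have h := induced_characterTopology H.subtype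
      (AddSubgroup.comap (restrictCharacter H) (continuousCharacters ζ))
    rw [hmap] at h
    exact h.trans hζ.eq_bohrModification.symm
  · rw [hτ'.eq_bohrModification]
    exact characterTopology_anti (continuousCharacters_le_comap hind.ge)

theorem IsPrecompactTopology.induced_subtype {τ : TopologicalSpace G}
    (hτ : IsPrecompactTopology τ) (H : AddSubgroup G) :
    IsPrecompactTopology (TopologicalSpace.induced (Subtype.val : H → G) τ) := by
  rw [hτ.eq_bohrModification]
  refine (induced_characterTopology H.subtype _).symm ▸
    isPrecompactTopology_characterTopology fun g hg => ?_
  obtain ⟨χ, hχ, hne⟩ := hτ.exists_mem_ne_zero (g := (g : G)) fun h => hg (Subtype.ext h)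
  exact ⟨_, ⟨χ, hχ, rfl⟩, hne⟩

theorem IsBEmbedded.mono {τ σ : TopologicalSpace G} {H : AddSubgroup G} (h : IsBEmbedded τ H)
    (hστ : σ ≤ τ) : IsBEmbedded σ H :=
  fun χ => continuous_le_dom (coinduced_mono hστ) (h χ)

/-- Closedness of `H` is not assumed: the quotient is Hausdorff because all its characters are
continuous and they separate points. -/
theorem IsBEmbedded.isPrecompactTopology_coinduced {τ : TopologicalSpace G} {H : AddSubgroup G}
    (h : IsBEmbedded τ H) (hτ : IsPrecompactTopology τ) :
    IsPrecompactTopology (TopologicalSpace.coinduced (QuotientAddGroup.mk' H) τ) where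
  isTopologicalAddGroup := by
    have := hτ.isTopologicalAddGroup
    exact inferInstanceAs (IsTopologicalAddGroup (G ⧸ H))
  t2Space := by
    have hT := t2Space_characterTopology (Γ := (⊤ : AddSubgroup (G ⧸ H →+ UnitAddCircle)))
      fun g hg => (exists_character_ne_zero hg).imp fun _ h => ⟨trivial, h⟩
    exact t2Space_antitone (le_characterTopology_iff.2 fun χ _ => h χ) hT
  totallyBounded U hU := by
    have hpre := preimage_mk_mem_nhds H hU
    obtain ⟨F, hF, hFU⟩ := hτ.totallyBounded _ hpre
    refine ⟨QuotientAddGroup.mk' H '' F, hF.image _, Set.eq_univ_of_forall fun x => ?_⟩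
    obtain ⟨g, rfl⟩ := QuotientAddGroup.mk'_surjective H x
    obtain ⟨a, ha, b, hb, rfl⟩ := hFU.ge (Set.mem_univ g)
    exact ⟨_, ⟨a, ha, rfl⟩, _, hb, (map_add (QuotientAddGroup.mk' H) a b).symm⟩

theorem IsBEmbedded.continuousCharacters_eq_comap {τ : TopologicalSpace G} {H : AddSubgroup G}
    (h : IsBEmbedded τ H) (hτ : IsPrecompactTopology τ) :
    continuousCharacters τ = AddSubgroup.comap (restrictCharacter H)
      (continuousCharacters (TopologicalSpace.induced (Subtype.val : H → G) τ)) := by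
  refine le_antisymm (continuousCharacters_le_comap le_rfl) fun χ hχ => ?_
  -- Adjoining `χ` changes nothing on `H`, where `χ` is already continuous, nor on `G ⧸ H`, where
  -- all characters already are; hence Merson's lemma applies.
  set Δ := continuousCharacters τ ⊔ AddSubgroup.zmultiples χ
  have hσ : IsPrecompactTopology (characterTopology Δ) :=
    isPrecompactTopology_characterTopology fun g hg =>
      (hτ.exists_mem_ne_zero hg).imp fun ψ hψ => ⟨le_sup_left (a := continuousCharacters τ) hψ.1, hψ.2⟩
  have hστ : characterTopology Δ ≤ τ :=
    (characterTopology_anti le_sup_left).trans hτ.eq_bohrModification.ge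
  have hle : τ ≤ characterTopology Δ := by
    refine le_of_induced_le_of_coinduced_le (H := H) hτ.isTopologicalAddGroup
      hσ.isTopologicalAddGroup hστ ?_ ?_
    · refine le_of_le_of_eq ?_ (induced_characterTopology H.subtype Δ).symm
      rw [le_characterTopology_iff, AddSubgroup.map_le_iff_le_comap]
      exact sup_le (continuousCharacters_le_comap le_rfl) (AddSubgroup.zmultiples_le.2 hχ)
    · rw [((h.mono hστ).isPrecompactTopology_coinduced hσ).eq_bohrModification]
      exact le_characterTopology_iff.2 fun ψ _ => h ψ
  exact le_characterTopology_iff.1 hle (le_sup_right (a := continuousCharacters τ)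
    (AddSubgroup.mem_zmultiples χ))

end Subgroups

theorem theoremB {G : Type*} [AddCommGroup G] (H : AddSubgroup G) :
    (∀ ζ : TopologicalSpace H, IsPrecompactTopology ζ →
      IsFinestPrecompactExtension H ζ (bohrModification (extendedTopology H ζ))) ∧
    (∀ τ : TopologicalSpace G, IsPrecompactTopology τ →
      ∀ ζ : TopologicalSpace H, ζ = TopologicalSpace.induced Subtype.val τ →
        List.TFAE [
          IsFinestPrecompactExtension H ζ τ,
          IsBEmbedded τ H,
          continuousCharacters τ =
            AddSubgroup.comap (restrictCharacter H) (continuousCharacters ζ),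
          τ = bohrModification (extendedTopology H ζ)]) := by
  refine ⟨fun ζ hζ => isFinestPrecompactExtension_bohrModification hζ, ?_⟩
  rintro τ hτ ζ rfl
  have hζ := hτ.induced_subtype H
  have hfin := isFinestPrecompactExtension_bohrModification hζ
  tfae_have 1 → 4 := fun h => le_antisymm
    (h.finest _ hfin.isPrecompactTopology hfin.induced_eq) (hfin.finest _ hτ rfl)
  tfae_have 4 → 1 := fun h => ⟨hτ, rfl, fun τ' hτ' hind => h.le.trans (hfin.finest τ' hτ' hind)⟩
  tfae_have 4 → 3 := fun h => by
    refine le_antisymm (continuousCharacters_le_comap le_rfl) ?_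
    rw [← continuousCharacters_extendedTopology hζ]
    exact le_characterTopology_iff.1 h.le
  tfae_have 3 → 4 := fun h => by
    rw [bohrModification, continuousCharacters_extendedTopology hζ, ← h]
    exact hτ.eq_bohrModification
  tfae_have 3 → 2 := fun h χ => by
    rw [continuous_coinduced_dom]
    have hmem : χ.comp (QuotientAddGroup.mk' H) ∈ continuousCharacters τ := by
      rw [h, AddSubgroup.mem_comap, restrictCharacter_comp_mk']
      exact zero_mem _
    exact hmem
  tfae_have 2 → 3 := fun h => h.continuousCharacters_eq_comap hτ
  tfae_finish
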